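/- Let $m\ge 1$ and let $\Gamma\subset\mathbb{R}^m\times\mathbb{R}$ be a (full-rank) lattice such that the coordinate projections $p_1:\mathbb{R}^m\times\mathbb{R}\to\mathbb{R}^m$ and $p_2:\mathbb{R}^m\times\mathbb{R}\to\mathbb{R}$ are both injective on $\Gamma$ and have dense images $p_1(\Gamma)\subset\mathbb{R}^m$, $p_2(\Gamma)\subset\mathbb{R}$. Let $\Omega\subset\mathbb{R}$ be a compact interval of positive length, symmetric around the origin, whose boundary contains no point of $p_2(\Gamma)$, and let $$\Lambda(\Omega)=\{p_1(\gamma):\gamma\in\Gamma,\ p_2(\gamma)\in\Omega\}$$ be the corresponding simple generic model set. Then the density $$D(\Lambda(\Omega))=\lim_{R\to\infty}\frac{\#\big(\Lambda(\Omega)\cap(x+R[0,1]^m)\big)}{R^m}$$ exists for every $x\in\mathbb{R}^m$ and does not depend on $x$. Let $\mathcal{K}$ be a countable index set and, for every $k\in\mathcal{K}$, let $g_k:\mathbb{R}^m\to\mathbb{C}$ belong to the Wiener amalgam space $W(L^2,\ell^1)$, i.e. $g_k$ is measurable and $\sum_{n\in\mathbb{Z}^m}\|g_k\mathbf{1}_{n+[0,1]^m}\|_2<\infty$.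 Write $T_\lambda g(t)=g(t-\lambda)$ and $\widehat{g}(t)=\int_{\mathbb{R}^m}g(s)e^{-2\pi i s\cdot t}\,ds$. Then the family $\{T_\lambda g_k:k\in\mathcal{K},\lambda\in\Lambda(\Omega)\}$ is a normalized tight frame for $L^2(\mathbb{R}^m)$, that is, $$\sum_{k\in\mathcal{K}}\sum_{\lambda\in\Lambda(\Omega)}|\langle f,T_\lambda g_k\rangle|^2=\|f\|_2^2\quad\text{for all } f\in L^2(\mathbb{R}^m),$$ if and only if it is a Bessel sequence with upper frame bound $1$, that is, $$\sum_{k\in\mathcal{K}}\sum_{\lambda\in\Lambda(\Omega)}|\langle f,T_\lambda g_k\rangle|^2\le\|f\|_2^2\quad\text{for all } f\in L^2(\mathbb{R}^m),$$ and $$D(\Lambda(\Omega))\sum_{k\in\mathcal{K}}|\widehat{g}_k(t)|^2=1\quad\text{for a.e. } t\in\mathbb{R}^m.$$ -/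

import Mathlib

open MeasureTheory Filter Topology
open scoped ENNReal ComplexConjugate FourierTransform

namespace ModelSetFrames

/-- The axis-parallel cube `R[0,1]^m + x` in `ℝ^m`. -/
def cube {m : ℕ} (x : EuclideanSpace ℝ (Fin m)) (R : ℝ) : Set (EuclideanSpace ℝ (Fin m)) :=
  {y | ∀ i, x i ≤ y i ∧ y i ≤ x i + R}

section ModelSets

variable {E F : Type*} [NormedAddCommGroup E] [NormedSpace ℝ E]
  [NormedAddCommGroup F] [NormedSpace ℝ F]

/-- `Γ` is a (full-rank) lattice in `E × F` such that both coordinate projections are injective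
on `Γ` and map `Γ` onto a dense subgroup. Being a lattice depends only on the topology and the
linear structure of the product, so the choice of norm on `E × F` is irrelevant. -/
structure IsCutAndProjectLattice (Γ : Submodule ℤ (E × F)) : Prop where
  discrete : DiscreteTopology Γ
  span_eq_top : Submodule.span ℝ (Γ : Set (E × F)) = ⊤
  injOn_fst : Set.InjOn Prod.fst (Γ : Set (E × F))
  dense_fst : Dense (Prod.fst '' (Γ : Set (E × F)))
  injOn_snd : Set.InjOn Prod.snd (Γ : Set (E × F))
  dense_snd : Dense (Prod.snd '' (Γ : Set (E × F)))

/-- A window: nonempty, compact, equal to the closure of its interior, with Lebesgue-null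
boundary. -/
structure IsWindow [MeasureSpace F] (Ω : Set F) : Prop where
  nonempty : Ω.Nonempty
  isCompact : IsCompact Ω
  closure_interior : closure (interior Ω) = Ω
  frontier_null : volume (frontier Ω) = 0

/-- The model set `Λ(Ω) = {p₁(γ) : γ ∈ Γ, p₂(γ) ∈ Ω}`. -/
def modelSet (Γ : Submodule ℤ (E × F)) (Ω : Set F) : Set E :=
  {x | ∃ γ ∈ Γ, γ.1 = x ∧ γ.2 ∈ Ω}

/-- `Λ(Ω)` is generic: no point of `p₂(Γ)` lies on the boundary of the window. -/
def IsGeneric (Γ : Submodule ℤ (E × F)) (Ω : Set F) : Prop :=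
  Disjoint (frontier Ω) (Prod.snd '' (Γ : Set (E × F)))

/-- The data `(Γ, Ω)` define a simple model set: the internal space is `ℝ` and the window is
an interval (an order-connected set). -/
structure IsSimple (Γ : Submodule ℤ (E × ℝ)) (Ω : Set ℝ) : Prop where
  lattice : IsCutAndProjectLattice Γ
  window : IsWindow Ω
  interval : Ω.OrdConnected

end ModelSets

section Analysis

variable {m : ℕ}

/-- `Λ ⊆ ℝ^m` has density `D`: for every `x`,
`#(Λ ∩ (R[0,1]^m + x)) / R^m → D` as `R → ∞`. -/
def HasDensity (Λ : Set (EuclideanSpace ℝ (Fin m))) (D : ℝ) : Prop :=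
  ∀ x : EuclideanSpace ℝ (Fin m),
    Tendsto (fun R : ℝ => ((Λ ∩ cube x R).ncard : ℝ) / R ^ m) atTop (𝓝 D)

/-- The density `D(Λ)`, the limit computed with cubes `R[0,1]^m` at the origin. (Its value is
meaningful only when the limit exists; see `HasDensity`.) -/
noncomputable def density (Λ : Set (EuclideanSpace ℝ (Fin m))) : ℝ :=
  limUnder atTop (fun R : ℝ => ((Λ ∩ cube 0 R).ncard : ℝ) / R ^ m)

/-- The Wiener amalgam space `W(L^p, ℓ^1)`: the sum over `n ∈ ℤ^m` of the `L^p` norms of `f`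
restricted to the cubes `[0,1]^m + n` is finite. -/
def MemAmalgamOne (p : ℝ≥0∞) (f : EuclideanSpace ℝ (Fin m) → ℂ) : Prop :=
  AEStronglyMeasurable f volume ∧
    ∑' n : Fin m → ℤ,
      eLpNorm ((cube (WithLp.toLp 2 fun i => (n i : ℝ)) 1).indicator f) p volume < ∞

/-- Translation `T_l f(t) = f(t - l)`. -/
def translate (l : EuclideanSpace ℝ (Fin m)) (f : EuclideanSpace ℝ (Fin m) → ℂ) :
    EuclideanSpace ℝ (Fin m) → ℂ := fun t => f (t - l)

/-- The `L²` pairing `⟨f, h⟩ = ∫ f(t) conj(h(t)) dt`. -/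
noncomputable def pairing (f h : EuclideanSpace ℝ (Fin m) → ℂ) : ℂ :=
  ∫ t, f t * conj (h t)

variable {K : Type*}

/-- `∑_k ∑_{l ∈ Λ} |⟨f, T_l g_k⟩|²`, as an element of `[0, ∞]`. -/
noncomputable def frameSum (g : K → EuclideanSpace ℝ (Fin m) → ℂ)
    (Λ : Set (EuclideanSpace ℝ (Fin m))) (f : EuclideanSpace ℝ (Fin m) → ℂ) : ℝ≥0∞ :=
  ∑' k, ∑' l : Λ, ‖pairing f (translate (l : EuclideanSpace ℝ (Fin m)) (g k))‖ₑ ^ 2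

/-- `{T_l g_k : k ∈ K, l ∈ Λ}` is a Bessel sequence for `L²(ℝ^m)` with upper frame bound `B`. -/
def IsBessel (g : K → EuclideanSpace ℝ (Fin m) → ℂ)
    (Λ : Set (EuclideanSpace ℝ (Fin m))) (B : ℝ) : Prop :=
  ∀ f : EuclideanSpace ℝ (Fin m) → ℂ, MemLp f 2 volume →
    frameSum g Λ f ≤ ENNReal.ofReal B * eLpNorm f 2 volume ^ 2

/-- `{T_l g_k : k ∈ K, l ∈ Λ}` is a frame for `L²(ℝ^m)` with lower and upper frame bounds
`A, B > 0`. -/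
def IsFrame (g : K → EuclideanSpace ℝ (Fin m) → ℂ)
    (Λ : Set (EuclideanSpace ℝ (Fin m))) (A B : ℝ) : Prop :=
  0 < A ∧ 0 < B ∧ IsBessel g Λ B ∧
    ∀ f : EuclideanSpace ℝ (Fin m) → ℂ, MemLp f 2 volume →
      ENNReal.ofReal A * eLpNorm f 2 volume ^ 2 ≤ frameSum g Λ f

/-- A normalized tight frame: a frame with both frame bounds equal to `1`. -/
def IsNormalizedTightFrame (g : K → EuclideanSpace ℝ (Fin m) → ℂ)
    (Λ : Set (EuclideanSpace ℝ (Fin m))) : Prop :=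
  IsFrame g Λ 1 1

end Analysis

end ModelSetFrames

/-!
For `f ∈ L²` the function `(x, u) ↦ 1_Ω(u) ∑_k |⟨f, T_x g_k⟩|²` on `ℝ^m × F` has as its
`Γ`-periodization at `(x, u)` the frame sum of `T_{-x} f` over `Λ(Ω - u)`. By Plancherel its
integral is `|Ω| ∫ |φ|² ∑_k |ĝ_k|²` when `f` is the inverse Fourier transform of `φ`.

Translating `f` by `p₁(γ)` has the same effect on the frame sum as shifting `Ω` by `p₂(γ)`, and
these shifts are dense, so Bessel bounds and the tight frame identity pass from `Ω` to almost every
shifted window. For a tight frame the periodization is therefore a.e. equal to `‖φ‖²`; integrating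
over a fundamental domain gives `|Ω| ∑_k |ĝ_k|² = covol Γ` a.e., and `D(Λ(Ω)) = |Ω| / covol Γ`.
Conversely, under the Bessel bound the periodization is a.e. at most `‖f‖²`, while the Fourier
condition says that its mean is `‖f‖²`; hence equality holds a.e. As `p₂(Γ)` avoids `∂Ω`, the frame
sum of `f` over `Λ(Ω - u)` is continuous at `u = 0`, and the Bessel bound makes the effect of a
small translation of `f` negligible, so equality holds at the origin too.
-/

namespace ModelSetFrames

section Lattice

variable {V : Type*} [NormedAddCommGroup V] {Γ : Submodule ℤ V}

/-- The `Γ`-periodization of `H`, whose integral over a fundamental domain of `Γ` is the integral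
of `H` over the whole space. -/
noncomputable def periodization (Γ : Submodule ℤ V) (H : V → ℝ≥0∞) (p : V) : ℝ≥0∞ :=
  ∑' γ : Γ, H (γ + p)

theorem periodization_add (H : V → ℝ≥0∞) (γ : Γ) (p : V) :
    periodization Γ H (γ + p) = periodization Γ H p := by
  simpa [periodization, add_assoc] using (Equiv.addRight γ).tsum_eq fun δ : Γ => H (δ + p)

theorem periodization_indicator_one (A : Set V) (p : V) :
    periodization Γ (A.indicator 1) p = ({γ : Γ | ↑γ + p ∈ A}.encard : ℝ≥0∞) := by
  rw [periodization, ← ENNReal.tsum_set_one, tsum_subtype (f := fun _ : Γ => (1 : ℝ≥0∞))]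
  rfl

variable [MeasurableSpace V] [BorelSpace V] {μ : Measure V} [μ.IsAddLeftInvariant]

instance vaddInvariantMeasure : VAddInvariantMeasure Γ V μ :=
  inferInstanceAs (VAddInvariantMeasure Γ.toAddSubgroup V μ)

theorem setLIntegral_periodization [Countable Γ] {D : Set V} (hD : IsAddFundamentalDomain Γ D μ)
    {H : V → ℝ≥0∞} (hH : Measurable H) : ∫⁻ p in D, periodization Γ H p ∂μ = ∫⁻ p, H p ∂μ := by
  unfold periodization
  rw [hD.lintegral_eq_tsum'', lintegral_tsum]
  · rfl
  · exact fun γ => (hH.comp (measurable_const_add _)).aemeasurable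

theorem encard_mul_measure_le [Countable Γ] {D A B : Set V} (hD : IsAddFundamentalDomain Γ D μ)
    (hDm : MeasurableSet D) (hB : MeasurableSet B)
    (h : ∀ d ∈ D, ∃ γ : Γ, ∀ a ∈ A, a + (γ + d) ∈ B) :
    ({γ : Γ | ↑γ ∈ A}.encard : ℝ≥0∞) * μ D ≤ μ B := by
  rw [← lintegral_indicator_one hB, ← setLIntegral_periodization hD (measurable_one.indicator hB),
    ← setLIntegral_const]
  refine setLIntegral_mono' hDm fun d hd => ?_
  obtain ⟨γ₀, hγ₀⟩ := h d hd
  rw [periodization_indicator_one, ENat.toENNReal_le]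
  refine Set.encard_le_encard_of_injOn (f := (· + γ₀)) (fun γ hγ => ?_)
    (add_left_injective γ₀).injOn
  simpa [add_assoc] using hγ₀ γ hγ

theorem measure_le_encard_mul [Countable Γ] {D A B : Set V} (hD : IsAddFundamentalDomain Γ D μ)
    (hDm : MeasurableSet D) (hA : MeasurableSet A)
    (h : ∀ d ∈ D, ∃ γ : Γ, ∀ a ∈ A, a - (γ + d) ∈ B) :
    μ A ≤ ({γ : Γ | ↑γ ∈ B}.encard : ℝ≥0∞) * μ D := by
  rw [← lintegral_indicator_one hA, ← setLIntegral_periodization hD (measurable_one.indicator hA),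
    ← setLIntegral_const]
  refine setLIntegral_mono' hDm fun d hd => ?_
  obtain ⟨γ₀, hγ₀⟩ := h d hd
  rw [periodization_indicator_one, ENat.toENNReal_le]
  refine Set.encard_le_encard_of_injOn (f := (· - γ₀)) (fun γ hγ => ?_) sub_left_injective.injOn
  simpa using hγ₀ _ hγ

end Lattice

section ZLattice

variable {V : Type*} [NormedAddCommGroup V] [NormedSpace ℝ V] [FiniteDimensional ℝ V]
  [MeasurableSpace V] [BorelSpace V] (Γ : Submodule ℤ V) [DiscreteTopology Γ] [IsZLattice ℝ Γ]
  (μ : Measure V) [μ.IsAddHaarMeasure]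

theorem exists_isAddFundamentalDomain : ∃ D : Set V, IsAddFundamentalDomain Γ D μ ∧
    MeasurableSet D ∧ Bornology.IsBounded D ∧ μ D = ENNReal.ofReal (ZLattice.covolume Γ μ) := by
  let b := Module.Free.chooseBasis ℤ Γ
  have hD := ZLattice.isAddFundamentalDomain b μ
  have hbdd := ZSpan.fundamentalDomain_isBounded (b.ofZLatticeBasis ℝ)
  refine ⟨_, hD, ZSpan.fundamentalDomain_measurableSet _, hbdd, ?_⟩
  rw [ZLattice.covolume_eq_measure_fundamentalDomain Γ μ hD, Measure.real,
    ENNReal.ofReal_toReal hbdd.measure_lt_top.ne]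

variable {Γ μ} {H : V → ℝ≥0∞} {B : ℝ≥0∞}

theorem lintegral_eq_of_periodization_ae_eq (hH : Measurable H)
    (h : ∀ᵐ p ∂μ, periodization Γ H p = B) :
    ∫⁻ p, H p ∂μ = B * ENNReal.ofReal (ZLattice.covolume Γ μ) := by
  obtain ⟨D, hD, -, -, hvol⟩ := exists_isAddFundamentalDomain Γ μ
  rw [← setLIntegral_periodization hD hH, lintegral_congr_ae (ae_restrict_of_ae h),
    setLIntegral_const, hvol]

theorem periodization_ae_eq_of_ae_le (hH : Measurable H) (hB : B ≠ ∞)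
    (hle : ∀ᵐ p ∂μ, periodization Γ H p ≤ B)
    (hmean : ∫⁻ p, H p ∂μ = B * ENNReal.ofReal (ZLattice.covolume Γ μ)) :
    ∀ᵐ p ∂μ, periodization Γ H p = B := by
  obtain ⟨D, hD, -, -, hvol⟩ := exists_isAddFundamentalDomain Γ μ
  rw [← setLIntegral_periodization hD hH] at hmean
  have hD_eq : ∀ᵐ p ∂μ.restrict D, periodization Γ H p = B := by
    refine ae_eq_of_ae_le_of_lintegral_le (ae_restrict_of_ae hle) ?_ aemeasurable_const ?_
    · exact hmean ▸ ENNReal.mul_ne_top hB ENNReal.ofReal_ne_top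
    · rw [hmean, setLIntegral_const, hvol]
  refine hD.measure_zero_of_invariant _ (fun γ => ?_) ?_
  · ext p
    rw [Set.mem_vadd_set_iff_neg_vadd_mem]
    change periodization Γ H (↑(-γ) + p) ≠ B ↔ _
    rw [periodization_add]
    rfl
  · rwa [ae_iff, Measure.restrict_apply₀' hD.nullMeasurableSet] at hD_eq

end ZLattice

section Cube

variable {m : ℕ}

theorem cube_eq_preimage (x : EuclideanSpace ℝ (Fin m)) (R : ℝ) :
    cube x R = (MeasurableEquiv.toLp 2 (Fin m → ℝ)).symm ⁻¹'
      Set.univ.pi fun i => Set.Icc (x i) (x i + R) := by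
  ext y
  simp [cube, Set.mem_pi, -Set.pi_univ_Icc]

theorem measurableSet_cube (x : EuclideanSpace ℝ (Fin m)) (R : ℝ) : MeasurableSet (cube x R) := by
  rw [cube_eq_preimage]
  exact (MeasurableEquiv.toLp 2 (Fin m → ℝ)).symm.measurable
    (MeasurableSet.univ_pi fun i => measurableSet_Icc)

theorem volume_cube (x : EuclideanSpace ℝ (Fin m)) (R : ℝ) :
    volume (cube x R) = ENNReal.ofReal R ^ m := by
  rw [cube_eq_preimage, (EuclideanSpace.volume_preserving_symm_measurableEquiv_toLp
    (Fin m)).measure_preimage_equiv, volume_pi_pi]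
  simp

theorem iUnion_cube_one : ⋃ n : Fin m → ℤ, cube (WithLp.toLp 2 fun i => (n i : ℝ)) 1 =
    (Set.univ : Set (EuclideanSpace ℝ (Fin m))) :=
  Set.eq_univ_of_forall fun y => Set.mem_iUnion.2
    ⟨fun i => ⌊y i⌋, fun _ => ⟨Int.floor_le _, (Int.lt_floor_add_one _).le⟩⟩

theorem add_mem_cube {x y v : EuclideanSpace ℝ (Fin m)} {R C : ℝ} (hy : y ∈ cube x R)
    (hv : ‖v‖ ≤ C) : y + v ∈ cube (x - WithLp.toLp 2 fun _ => C) (R + 2 * C) := fun i => by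
  have hvi := abs_le.1 ((PiLp.norm_apply_le v i).trans hv)
  have hyi := hy i
  simp only [PiLp.add_apply, PiLp.sub_apply]
  constructor <;> linarith

end Cube

section ModelSetCount

theorem exists_add_mem_of_dense_snd {E F : Type*} [NormedAddCommGroup E] [NormedAddCommGroup F]
    [ProperSpace F] {Γ : Submodule ℤ (E × F)} (hΓ : Dense (Prod.snd '' (Γ : Set (E × F))))
    {D : Set (E × F)} (hD : Bornology.IsBounded D) {ε : ℝ} (hε : 0 < ε) :
    ∃ C : ℝ, ∀ d ∈ D, ∃ γ : Γ, ‖(γ + d).1‖ ≤ C ∧ ‖(γ + d).2‖ < ε := by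
  obtain ⟨r, hr⟩ := hD.exists_norm_le
  obtain ⟨T, hT⟩ := (isCompact_closedBall (0 : F) r).elim_finite_subcover
    (fun γ : Γ => Metric.ball (-γ.1.2) ε) (fun _ => Metric.isOpen_ball) fun t _ => by
      obtain ⟨_, hball, γ, hγ, rfl⟩ := Metric.dense_iff.1 hΓ (-t) ε hε
      refine Set.mem_iUnion.2 ⟨⟨γ, hγ⟩, ?_⟩
      simpa [dist_eq_norm, add_comm] using hball
  refine ⟨∑ γ ∈ T, ‖γ.1.1‖ + r, fun d hd => ?_⟩
  obtain ⟨γ, hγT, hγ⟩ := Set.mem_iUnion₂.1 <| hT <| mem_closedBall_zero_iff.2 <|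
    (norm_snd_le d).trans (hr d hd)
  refine ⟨γ, (norm_add_le _ _).trans (add_le_add ?_ ((norm_fst_le d).trans (hr d hd))), ?_⟩
  · exact Finset.single_le_sum (f := fun γ : Γ => ‖γ.1.1‖) (fun _ _ => norm_nonneg _) hγT
  · simpa [dist_eq_norm, add_comm] using hγ

variable {E F : Type*} [NormedAddCommGroup E] [NormedAddCommGroup F]
  {Γ : Submodule ℤ (E × F)}

theorem modelSet_eq_image (Ω : Set F) :
    modelSet Γ Ω = (fun γ : Γ => γ.1.1) '' {γ : Γ | γ.1.2 ∈ Ω} := by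
  ext y
  constructor
  · rintro ⟨γ, hγ, rfl, hΩ⟩
    exact ⟨⟨γ, hγ⟩, hΩ, rfl⟩
  · rintro ⟨γ, hΩ, rfl⟩
    exact ⟨γ, γ.2, rfl, hΩ⟩

theorem encard_modelSet_inter (hinj : Set.InjOn Prod.fst (Γ : Set (E × F))) (Ω : Set F)
    (S : Set E) : (modelSet Γ Ω ∩ S).encard = {γ : Γ | ↑γ ∈ S ×ˢ Ω}.encard := by
  have hinj' : Function.Injective fun γ : Γ => γ.1.1 := Set.injOn_iff_injective.1 hinj
  rw [modelSet_eq_image, ← Set.image_inter_preimage, hinj'.encard_image, Set.inter_comm]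
  rfl

theorem tendsto_ofReal_add_pow_div (c : ℝ) (m : ℕ) :
    Tendsto (fun R : ℝ => ENNReal.ofReal (R + c) ^ m / ENNReal.ofReal R ^ m) atTop (𝓝 1) := by
  have hreal : Tendsto (fun R : ℝ => (1 + c / R) ^ m) atTop (𝓝 1) := by
    simpa using ((tendsto_const_nhds.div_atTop tendsto_id).const_add (1 : ℝ)).pow m
  rw [← ENNReal.ofReal_one]
  refine (ENNReal.tendsto_ofReal hreal).congr' ?_
  filter_upwards [eventually_gt_atTop 0, eventually_ge_atTop (-c)] with R hR hRc
  have hRc' : 0 ≤ R + c := by linarith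
  rw [← ENNReal.ofReal_pow hRc', ← ENNReal.ofReal_pow hR.le,
    ← ENNReal.ofReal_div_of_pos (by positivity), ← div_pow, add_div, div_self hR.ne']

end ModelSetCount

section Density

variable {m : ℕ} {F : Type*} [NormedAddCommGroup F] [NormedSpace ℝ F] [FiniteDimensional ℝ F]
  [MeasureSpace F] [BorelSpace F] [(volume : Measure F).IsAddHaarMeasure]
  {Γ : Submodule ℤ (EuclideanSpace ℝ (Fin m) × F)} [DiscreteTopology Γ] [IsZLattice ℝ Γ]

instance isAddHaarMeasure_volume_prod :
    (volume : Measure (EuclideanSpace ℝ (Fin m) × F)).IsAddHaarMeasure :=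
  inferInstanceAs ((volume : Measure (EuclideanSpace ℝ (Fin m))).prod
    (volume : Measure F)).IsAddHaarMeasure

theorem encard_cube_prod_bounds
    (hdense : Dense (Prod.snd '' (Γ : Set (EuclideanSpace ℝ (Fin m) × F)))) {K U : Set F}
    (hK : IsCompact K) (hU : IsOpen U) (hKU : K ⊆ U) :
    ∃ C : ℝ, ∀ (x : EuclideanSpace ℝ (Fin m)) (R : ℝ),
      ({γ : Γ | ↑γ ∈ cube x R ×ˢ K}.encard : ℝ≥0∞) * ENNReal.ofReal (ZLattice.covolume Γ) ≤
          ENNReal.ofReal (R + 2 * C) ^ m * volume U ∧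
        ENNReal.ofReal (R + -(2 * C)) ^ m * volume K ≤
          ({γ : Γ | ↑γ ∈ cube x R ×ˢ U}.encard : ℝ≥0∞) *
            ENNReal.ofReal (ZLattice.covolume Γ) := by
  obtain ⟨ε, hε, hKε⟩ := hK.exists_thickening_subset_open hU hKU
  obtain ⟨D, hD, hDm, hDb, hvol⟩ := exists_isAddFundamentalDomain Γ volume
  obtain ⟨C, hC⟩ := exists_add_mem_of_dense_snd hdense hDb hε
  have hadd {k v : F} (hk : k ∈ K) (hv : ‖v‖ < ε) : k + v ∈ U :=
    hKε (Metric.mem_thickening_iff.2 ⟨k, hk, by simpa using hv⟩)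
  refine ⟨C, fun x R => ⟨?_, ?_⟩⟩
  · rw [← volume_cube (x - WithLp.toLp 2 fun _ => C), ← Measure.prod_prod, ← hvol]
    refine encard_mul_measure_le hD hDm ((measurableSet_cube _ _).prod hU.measurableSet)
      fun d hd => ?_
    obtain ⟨γ, h1, h2⟩ := hC d hd
    exact ⟨γ, fun a ha => ⟨add_mem_cube ha.1 h1, hadd ha.2 h2⟩⟩
  · rw [← volume_cube (x + WithLp.toLp 2 fun _ => C), ← Measure.prod_prod, ← hvol]
    refine measure_le_encard_mul hD hDm ((measurableSet_cube _ _).prod hK.measurableSet)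
      fun d hd => ?_
    obtain ⟨γ, h1, h2⟩ := hC d hd
    refine ⟨γ, fun a ha => ?_⟩
    rw [sub_eq_add_neg]
    refine ⟨?_, hadd ha.2 ((norm_neg _).trans_lt h2)⟩
    simpa using add_mem_cube ha.1 ((norm_neg _).trans_le h1)

theorem tendsto_encard_modelSet_inter_cube
    (hinj : Set.InjOn Prod.fst (Γ : Set (EuclideanSpace ℝ (Fin m) × F)))
    (hdense : Dense (Prod.snd '' (Γ : Set (EuclideanSpace ℝ (Fin m) × F)))) {Ω : Set F}
    (hΩ : IsCompact Ω) (hfr : volume (frontier Ω) = 0) (x : EuclideanSpace ℝ (Fin m)) :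
    Tendsto (fun R : ℝ => ((modelSet Γ Ω ∩ cube x R).encard : ℝ≥0∞) *
      ENNReal.ofReal (ZLattice.covolume Γ) / ENNReal.ofReal R ^ m) atTop (𝓝 (volume Ω)) := by
  have hlim (c : ℝ) {w : ℝ≥0∞} (hw : w ≠ ∞) : Tendsto
      (fun R : ℝ => ENNReal.ofReal (R + c) ^ m * w / ENNReal.ofReal R ^ m) atTop (𝓝 w) := by
    simpa [ENNReal.mul_div_right_comm] using
      ENNReal.Tendsto.mul_const (tendsto_ofReal_add_pow_div c m) (Or.inr hw)
  simp only [encard_modelSet_inter hinj]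
  refine tendsto_order.2 ⟨fun l hl => ?_, fun l hl => ?_⟩
  · rw [← interior_ae_eq_of_null_frontier hfr |> measure_congr] at hl
    obtain ⟨K, hKΩ, hK, hlK⟩ := isOpen_interior.exists_lt_isCompact hl
    obtain ⟨C, hC⟩ := encard_cube_prod_bounds hdense hK isOpen_interior hKΩ
    filter_upwards [(hlim (-(2 * C)) hK.measure_lt_top.ne).eventually_const_lt hlK] with R hR
    refine hR.trans_le (ENNReal.div_le_div_right ((hC x R).2.trans ?_) _)
    gcongr
    exact interior_subset
  · obtain ⟨U, hΩU, hU, hUl⟩ := Ω.exists_isOpen_lt_of_lt l hl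
    obtain ⟨C, hC⟩ := encard_cube_prod_bounds hdense hΩ hU hΩU
    filter_upwards [(hlim (2 * C) hUl.ne_top).eventually_lt_const hUl] with R hR
    exact (ENNReal.div_le_div_right (hC x R).1 _).trans_lt hR

theorem hasDensity_modelSet
    (hinj : Set.InjOn Prod.fst (Γ : Set (EuclideanSpace ℝ (Fin m) × F)))
    (hdense : Dense (Prod.snd '' (Γ : Set (EuclideanSpace ℝ (Fin m) × F)))) {Ω : Set F}
    (hΩ : IsCompact Ω) (hfr : volume (frontier Ω) = 0) :
    HasDensity (modelSet Γ Ω) (volume.real Ω / ZLattice.covolume Γ) := fun x => by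
  have hcov := ZLattice.covolume_pos Γ volume
  have hreal := ((ENNReal.tendsto_toReal hΩ.measure_lt_top.ne).comp
    (tendsto_encard_modelSet_inter_cube hinj hdense hΩ hfr x)).div_const (ZLattice.covolume Γ)
  refine hreal.congr' ?_
  filter_upwards [eventually_ge_atTop 0] with R hR
  have hncard : ((modelSet Γ Ω ∩ cube x R).encard : ℝ≥0∞).toReal =
      (modelSet Γ Ω ∩ cube x R).ncard := by
    rw [Set.ncard]
    cases (modelSet Γ Ω ∩ cube x R).encard <;> simp
  simp only [Function.comp_apply, ENNReal.toReal_div, ENNReal.toReal_mul, ENNReal.toReal_pow,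
    ENNReal.toReal_ofReal hR, ENNReal.toReal_ofReal hcov.le, hncard]
  field_simp

theorem HasDensity.density_eq {Λ : Set (EuclideanSpace ℝ (Fin m))} {d : ℝ} (h : HasDensity Λ d) :
    density Λ = d :=
  (h 0).limUnder_eq

end Density


section ShiftedSets

theorem eventually_mem_iff_of_notMem_frontier {X : Type*} [TopologicalSpace X] {Ω : Set X} {u : X}
    (hu : u ∉ frontier Ω) : ∀ᶠ v in 𝓝 u, v ∈ Ω ↔ u ∈ Ω := by
  by_cases hmem : u ∈ Ω
  · filter_upwards [mem_interior_iff_mem_nhds.1 ((mem_interior_iff_notMem_frontier hmem).2 hu)]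
      with v hv
    exact iff_of_true hv hmem
  · have hcl : u ∉ closure Ω := fun hcl => hu ⟨hcl, fun hint => hmem (interior_subset hint)⟩
    filter_upwards [isClosed_closure.isOpen_compl.mem_nhds hcl] with v hv
    exact iff_of_false (fun h => hv (subset_closure h)) hmem

theorem isLocallyFiniteMeasure_of_dense_shifts {F : Type*} [AddCommGroup F] [TopologicalSpace F]
    [IsTopologicalAddGroup F] [MeasurableSpace F] {ν : Measure F} {Ω T : Set F}
    (hΩ : (interior Ω).Nonempty) (hT : Dense T) (h : ∀ t ∈ T, ν ((· + t) ⁻¹' Ω) < ∞) :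
    IsLocallyFiniteMeasure ν := by
  refine ⟨fun s => ?_⟩
  obtain ⟨t, hst, ht⟩ := hT.inter_open_nonempty ((s + ·) ⁻¹' interior Ω)
    (isOpen_interior.preimage (continuous_const_add s)) (hΩ.preimage (add_left_surjective s))
  refine ⟨_, ?_, h t ht⟩
  exact mem_of_superset ((isOpen_interior.preimage (continuous_add_const t)).mem_nhds hst)
    (Set.preimage_mono interior_subset)

theorem continuousAt_measure_shift {F : Type*} [NormedAddCommGroup F] [ProperSpace F]
    [MeasurableSpace F] [BorelSpace F] {ν : Measure F} [IsLocallyFiniteMeasure ν] {Ω : Set F}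
    (hΩ : MeasurableSet Ω) (hΩb : Bornology.IsBounded Ω) {s : F}
    (hs : ν ((· + s) ⁻¹' frontier Ω) = 0) :
    ContinuousAt (fun s' => ν ((· + s') ⁻¹' Ω)) s := by
  obtain ⟨r, hr⟩ := hΩb.exists_norm_le
  refine tendsto_measure_of_ae_tendsto_indicator (𝓝 s) ((measurable_add_const s) hΩ)
    (fun s' => (measurable_add_const s') hΩ) (B := Metric.closedBall 0 (r + (‖s‖ + 1)))
    measurableSet_closedBall measure_closedBall_lt_top.ne ?_ ?_
  · filter_upwards [Metric.ball_mem_nhds s one_pos] with s' hs' u hu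
    rw [mem_closedBall_zero_iff, ← add_sub_cancel_right u s']
    refine (norm_sub_le _ _).trans (add_le_add (hr _ hu) ?_)
    rw [← sub_add_cancel s' s, add_comm ‖s‖]
    exact (norm_add_le _ _).trans (by gcongr; exact (mem_ball_iff_norm.1 hs').le)
  · filter_upwards [measure_eq_zero_iff_ae_notMem.1 hs] with u hu
    have hcont : Tendsto (u + ·) (𝓝 s) (𝓝 (u + s)) := (continuous_const_add u).tendsto s
    exact hcont.eventually (eventually_mem_iff_of_notMem_frontier hu)

end ShiftedSets

section Pairing

variable {m : ℕ}

theorem pairing_translate_add (f h : EuclideanSpace ℝ (Fin m) → ℂ)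
    (x y : EuclideanSpace ℝ (Fin m)) :
    pairing f (translate (y + x) h) = pairing (translate (-x) f) (translate y h) := by
  unfold pairing translate
  rw [← integral_add_right_eq_self _ x]
  simp [sub_add_eq_sub_sub, add_sub_right_comm]

theorem translate_zero (f : EuclideanSpace ℝ (Fin m) → ℂ) : translate 0 f = f :=
  funext fun t => congrArg f (sub_zero t)

theorem eLpNorm_translate {f : EuclideanSpace ℝ (Fin m) → ℂ} {p : ℝ≥0∞} (hf : MemLp f p)
    (x : EuclideanSpace ℝ (Fin m)) : eLpNorm (translate x f) p = eLpNorm f p :=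
  eLpNorm_comp_measurePreserving hf.1 (measurePreserving_sub_right volume x)

theorem memLp_translate {f : EuclideanSpace ℝ (Fin m) → ℂ} {p : ℝ≥0∞} (hf : MemLp f p)
    (x : EuclideanSpace ℝ (Fin m)) : MemLp (translate x f) p :=
  hf.comp_measurePreserving (measurePreserving_sub_right volume x)

theorem tendsto_eLpNorm_translate_sub {f : EuclideanSpace ℝ (Fin m) → ℂ} {p : ℝ≥0∞}
    [Fact (1 ≤ p)] [Fact (p ≠ ∞)] (hf : MemLp f p) :
    Tendsto (fun x => eLpNorm (translate (-x) f - f) p) (𝓝 0) (𝓝 0) := by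
  have hcont : Continuous fun x : EuclideanSpace ℝ (Fin m) =>
      edist (DomAddAct.mk x +ᵥ hf.toLp f) (hf.toLp f) :=
    (DomAddAct.continuous_mk.vadd continuous_const).edist continuous_const
  have hlim := hcont.tendsto 0
  rw [DomAddAct.mk_zero, zero_vadd, edist_self] at hlim
  refine hlim.congr fun x => ?_
  rw [DomAddAct.mk_vadd_toLp, Lp.edist_toLp_toLp]
  congr 1
  ext t
  simp [translate, add_comm]

theorem pairing_add {f h e : EuclideanSpace ℝ (Fin m) → ℂ} (hf : MemLp f 2) (hh : MemLp h 2)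
    (he : MemLp e 2) : pairing (f + h) e = pairing f e + pairing h e := by
  have he' : MemLp (fun t => conj (e t)) 2 := he.star
  simp only [pairing, Pi.add_apply, add_mul]
  exact integral_add (hf.integrable_mul he') (hh.integrable_mul he')

end Pairing

section AnalysisNorm

variable {m : ℕ} {K : Type*} {g : K → EuclideanSpace ℝ (Fin m) → ℂ}
  {Λ : Set (EuclideanSpace ℝ (Fin m))} {f h : EuclideanSpace ℝ (Fin m) → ℂ}

/-- The `ℓ²` norm of the family of frame coefficients `⟨f, T_l g_k⟩`, `k ∈ K`, `l ∈ Λ`, possibly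
infinite: the seminorm whose square is `frameSum g Λ f`. -/
noncomputable def analysisNorm (g : K → EuclideanSpace ℝ (Fin m) → ℂ)
    (Λ : Set (EuclideanSpace ℝ (Fin m))) (f : EuclideanSpace ℝ (Fin m) → ℂ) : ℝ≥0∞ :=
  frameSum g Λ f ^ (1 / 2 : ℝ)

theorem analysisNorm_sq : analysisNorm g Λ f ^ 2 = frameSum g Λ f := by
  rw [analysisNorm, ← ENNReal.rpow_natCast, ← ENNReal.rpow_mul]
  norm_num

theorem analysisNorm_le_iff {B : ℝ≥0∞} : analysisNorm g Λ f ≤ B ↔ frameSum g Λ f ≤ B ^ 2 := by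
  rw [← analysisNorm_sq, ENNReal.pow_le_pow_left_iff two_ne_zero]

theorem le_analysisNorm_iff {B : ℝ≥0∞} : B ≤ analysisNorm g Λ f ↔ B ^ 2 ≤ frameSum g Λ f := by
  rw [← analysisNorm_sq, ENNReal.pow_le_pow_left_iff two_ne_zero]

theorem analysisNorm_eq_eLpNorm [MeasurableSpace (K × Λ)] [MeasurableSingletonClass (K × Λ)] :
    analysisNorm g Λ f = eLpNorm
      (fun i : K × Λ => pairing f (translate (i.2 : EuclideanSpace ℝ (Fin m)) (g i.1))) 2
      Measure.count := by
  rw [analysisNorm, eLpNorm_eq_lintegral_rpow_enorm_toReal two_ne_zero ENNReal.ofNat_ne_top,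
    lintegral_count, ENNReal.tsum_prod', frameSum]
  simp

theorem analysisNorm_add_le (hg : ∀ k, MemLp (g k) 2) (hf : MemLp f 2) (hh : MemLp h 2) :
    analysisNorm g Λ (f + h) ≤ analysisNorm g Λ f + analysisNorm g Λ h := by
  let : MeasurableSpace (K × Λ) := ⊤
  simp only [analysisNorm_eq_eLpNorm, pairing_add hf hh (memLp_translate (hg _) _)]
  exact eLpNorm_add_le measurable_from_top.aestronglyMeasurable
    measurable_from_top.aestronglyMeasurable one_le_two

theorem IsBessel.analysisNorm_le (hB : IsBessel g Λ 1) (hf : MemLp f 2) :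
    analysisNorm g Λ f ≤ eLpNorm f 2 :=
  analysisNorm_le_iff.2 (by simpa using hB f hf)

end AnalysisNorm

section ModelSetFrameSum

variable {m : ℕ} {F : Type*} [NormedAddCommGroup F]
  {Γ : Submodule ℤ (EuclideanSpace ℝ (Fin m) × F)} {K : Type*}
  {g : K → EuclideanSpace ℝ (Fin m) → ℂ} {f : EuclideanSpace ℝ (Fin m) → ℂ} {Ω : Set F}

/-- The energy `∑_k |⟨f, T_x g_k⟩|²` of `f` at the point `x`, so that `frameSum g Λ f` is the sum
of the energies over `Λ`. -/
noncomputable def energy (g : K → EuclideanSpace ℝ (Fin m) → ℂ)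
    (f : EuclideanSpace ℝ (Fin m) → ℂ) (x : EuclideanSpace ℝ (Fin m)) : ℝ≥0∞ :=
  ∑' k, ‖pairing f (translate x (g k))‖ₑ ^ 2

/-- The function `1_Ω(u) ∑_k |⟨f, T_x g_k⟩|²` on `ℝ^m × F`, whose `Γ`-periodization collects the
frame sums of all translates of `f` over the model sets of all shifted windows. -/
noncomputable def windowEnergy (g : K → EuclideanSpace ℝ (Fin m) → ℂ) (Ω : Set F)
    (f : EuclideanSpace ℝ (Fin m) → ℂ) (q : EuclideanSpace ℝ (Fin m) × F) : ℝ≥0∞ :=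
  Ω.indicator (fun _ => energy g f q.1) q.2

theorem energy_add (x y : EuclideanSpace ℝ (Fin m)) :
    energy g f (y + x) = energy g (translate (-x) f) y := by
  simp only [energy, pairing_translate_add]

theorem frameSum_eq_tsum_energy (Λ : Set (EuclideanSpace ℝ (Fin m))) :
    frameSum g Λ f = ∑' l : Λ, energy g f l :=
  ENNReal.tsum_comm

theorem frameSum_modelSet (hinj : Set.InjOn Prod.fst (Γ : Set (EuclideanSpace ℝ (Fin m) × F))) :
    frameSum g (modelSet Γ Ω) f = ∑' γ : Γ, windowEnergy g Ω f γ := by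
  have hinj' : Function.Injective fun γ : Γ => γ.1.1 := Set.injOn_iff_injective.1 hinj
  rw [frameSum_eq_tsum_energy, modelSet_eq_image, tsum_image (energy g f) hinj'.injOn,
    tsum_subtype {γ : Γ | γ.1.2 ∈ Ω} fun γ => energy g f γ.1.1]
  rfl

theorem periodization_windowEnergy
    (hinj : Set.InjOn Prod.fst (Γ : Set (EuclideanSpace ℝ (Fin m) × F)))
    (p : EuclideanSpace ℝ (Fin m) × F) : periodization Γ (windowEnergy g Ω f) p =
      frameSum g (modelSet Γ ((· + p.2) ⁻¹' Ω)) (translate (-p.1) f) := by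
  rw [frameSum_modelSet hinj, periodization]
  simp only [windowEnergy, Prod.fst_add, Prod.snd_add, energy_add]
  rfl

theorem frameSum_modelSet_shift
    (hinj : Set.InjOn Prod.fst (Γ : Set (EuclideanSpace ℝ (Fin m) × F))) (γ : Γ) :
    frameSum g (modelSet Γ ((· + γ.1.2) ⁻¹' Ω)) f =
      frameSum g (modelSet Γ Ω) (translate γ.1.1 f) := by
  have h0 := periodization_windowEnergy (g := g) (f := f) (Ω := Ω) hinj (0, γ.1.2)
  have h1 := periodization_windowEnergy (g := g) (f := f) (Ω := Ω) hinj (-γ.1.1, 0)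
  have hγ : ((0, γ.1.2) : EuclideanSpace ℝ (Fin m) × F) = γ.1 + (-γ.1.1, 0) := by ext <;> simp
  rw [hγ, periodization_add, h1] at h0
  simpa [translate_zero] using h0.symm

variable [MeasurableSpace F]

/-- The point masses `∑_k |⟨f, T_{p₁(γ)} g_k⟩|²` at the points `p₂(γ)`, `γ ∈ Γ`, of the internal
space: the measure of a window is the frame sum over its model set. -/
noncomputable def internalMeasure (Γ : Submodule ℤ (EuclideanSpace ℝ (Fin m) × F))
    (g : K → EuclideanSpace ℝ (Fin m) → ℂ) (f : EuclideanSpace ℝ (Fin m) → ℂ) : Measure F :=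
  Measure.sum fun γ : Γ => energy g f γ.1.1 • Measure.dirac γ.1.2

theorem internalMeasure_apply {A : Set F} (hA : MeasurableSet A) :
    internalMeasure Γ g f A = ∑' γ : Γ, windowEnergy g A f γ := by
  rw [internalMeasure, Measure.sum_apply _ hA]
  refine tsum_congr fun γ => ?_
  by_cases hγ : γ.1.2 ∈ A <;> simp [windowEnergy, hA, hγ]

theorem internalMeasure_eq_zero {A : Set F} (hA : MeasurableSet A) (h : ∀ γ : Γ, γ.1.2 ∉ A) :
    internalMeasure Γ g f A = 0 := by
  simp [internalMeasure_apply hA, windowEnergy, h]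

theorem continuousAt_frameSum_modelSet_shift [BorelSpace F] [ProperSpace F]
    (hinj : Set.InjOn Prod.fst (Γ : Set (EuclideanSpace ℝ (Fin m) × F)))
    (hdense : Dense (Prod.snd '' (Γ : Set (EuclideanSpace ℝ (Fin m) × F))))
    (hΩ : IsCompact Ω) (hint : (interior Ω).Nonempty)
    (hfin : ∀ y, frameSum g (modelSet Γ Ω) (translate y f) < ∞) {s : F}
    (hs : ∀ γ : Γ, γ.1.2 + s ∉ frontier Ω) :
    ContinuousAt (fun s' => frameSum g (modelSet Γ ((· + s') ⁻¹' Ω)) f) s := by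
  have heq (s' : F) : frameSum g (modelSet Γ ((· + s') ⁻¹' Ω)) f =
      internalMeasure Γ g f ((· + s') ⁻¹' Ω) := by
    rw [frameSum_modelSet hinj, internalMeasure_apply (measurable_add_const s' hΩ.measurableSet)]
  have : IsLocallyFiniteMeasure (internalMeasure Γ g f) := by
    refine isLocallyFiniteMeasure_of_dense_shifts hint hdense ?_
    rintro _ ⟨γ, hγ, rfl⟩
    rw [← heq, frameSum_modelSet_shift hinj ⟨γ, hγ⟩]
    exact hfin γ.1
  simp only [heq]
  exact continuousAt_measure_shift hΩ.measurableSet hΩ.isBounded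
    (internalMeasure_eq_zero (measurable_add_const s measurableSet_frontier) hs)

theorem frameSum_modelSet_shift_mem [BorelSpace F] [ProperSpace F]
    (hinj : Set.InjOn Prod.fst (Γ : Set (EuclideanSpace ℝ (Fin m) × F)))
    (hdense : Dense (Prod.snd '' (Γ : Set (EuclideanSpace ℝ (Fin m) × F))))
    (hΩ : IsCompact Ω) (hint : (interior Ω).Nonempty)
    (hfin : ∀ y, frameSum g (modelSet Γ Ω) (translate y f) < ∞) {C : Set ℝ≥0∞} (hC : IsClosed C)
    (hmem : ∀ y, frameSum g (modelSet Γ Ω) (translate y f) ∈ C) {s : F}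
    (hs : ∀ γ : Γ, γ.1.2 + s ∉ frontier Ω) :
    frameSum g (modelSet Γ ((· + s) ⁻¹' Ω)) f ∈ C := by
  have hcont := continuousAt_frameSum_modelSet_shift hinj hdense hΩ hint hfin hs
  refine closure_minimal (Set.image_subset_iff.2 ?_) hC
    (mem_closure_image (f := fun s' => frameSum g (modelSet Γ ((· + s') ⁻¹' Ω)) f) hcont (hdense s))
  rintro _ ⟨γ, hγ, rfl⟩
  rw [Set.mem_preimage, frameSum_modelSet_shift hinj ⟨γ, hγ⟩]
  exact hmem γ.1

end ModelSetFrameSum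

section Amalgam

theorem tsum_rpow_le_rpow_tsum {ι : Type*} (a : ι → ℝ≥0∞) {r : ℝ} (hr : 1 ≤ r) :
    ∑' i, a i ^ r ≤ (∑' i, a i) ^ r := by
  have hsplit (x : ℝ≥0∞) : x ^ r = x * x ^ (r - 1) := by
    nth_rw 2 [← ENNReal.rpow_one x]
    rw [← ENNReal.rpow_add_of_nonneg _ _ zero_le_one (sub_nonneg.2 hr), add_sub_cancel]
  rw [hsplit (∑' i, a i), ← ENNReal.tsum_mul_right]
  refine ENNReal.tsum_le_tsum fun i => ?_
  rw [hsplit (a i)]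
  exact mul_le_mul' le_rfl (ENNReal.rpow_le_rpow (ENNReal.le_tsum i) (sub_nonneg.2 hr))

theorem eLpNorm_le_tsum_eLpNorm_indicator {X E ι : Type*} [MeasurableSpace X] {μ : Measure X}
    [NormedAddCommGroup E] [Countable ι] {s : ι → Set X} (hs : ∀ i, MeasurableSet (s i))
    (hU : ⋃ i, s i = Set.univ) {p : ℝ≥0∞} (hp : 1 ≤ p) (hp' : p ≠ ∞) (f : X → E) :
    eLpNorm f p μ ≤ ∑' i, eLpNorm ((s i).indicator f) p μ := by
  lift p to NNReal using hp'
  have hp1 : (1 : ℝ) ≤ p := by exact_mod_cast hp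
  have hp0 : p ≠ 0 := (zero_lt_one.trans_le (by exact_mod_cast hp)).ne'
  refine (ENNReal.rpow_le_rpow_iff (zero_lt_one.trans_le hp1)).1 ?_
  calc eLpNorm f p μ ^ (p : ℝ) = ∫⁻ x in ⋃ i, s i, ‖f x‖ₑ ^ (p : ℝ) ∂μ := by
        rw [eLpNorm_nnreal_pow_eq_lintegral hp0, hU, setLIntegral_univ]
    _ ≤ ∑' i, ∫⁻ x in s i, ‖f x‖ₑ ^ (p : ℝ) ∂μ := lintegral_iUnion_le _ _
    _ = ∑' i, eLpNorm ((s i).indicator f) p μ ^ (p : ℝ) := by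
        simp only [eLpNorm_indicator_eq_eLpNorm_restrict (hs _),
          eLpNorm_nnreal_pow_eq_lintegral hp0]
    _ ≤ (∑' i, eLpNorm ((s i).indicator f) p μ) ^ (p : ℝ) := tsum_rpow_le_rpow_tsum _ hp1

variable {m : ℕ} {f : EuclideanSpace ℝ (Fin m) → ℂ} {p q : ℝ≥0∞}

theorem MemAmalgamOne.memLp (hf : MemAmalgamOne p f) (hp : 1 ≤ p) (hp' : p ≠ ∞) : MemLp f p :=
  ⟨hf.1, (eLpNorm_le_tsum_eLpNorm_indicator (fun _ => measurableSet_cube _ _) iUnion_cube_one hp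
    hp' f).trans_lt hf.2⟩

theorem MemAmalgamOne.mono (hf : MemAmalgamOne p f) (hqp : q ≤ p) : MemAmalgamOne q f := by
  refine ⟨hf.1, (ENNReal.tsum_le_tsum fun n => ?_).trans_lt hf.2⟩
  have : IsProbabilityMeasure (volume.restrict (cube (WithLp.toLp 2 fun i => (n i : ℝ)) 1)) :=
    ⟨by simp [volume_cube]⟩
  simp only [eLpNorm_indicator_eq_eLpNorm_restrict (measurableSet_cube _ _)]
  exact eLpNorm_le_eLpNorm_of_exponent_le hqp hf.1.restrict

theorem MemAmalgamOne.integrable (hf : MemAmalgamOne 1 f) : Integrable f :=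
  memLp_one_iff_integrable.1 (hf.memLp le_rfl ENNReal.one_ne_top)

end Amalgam

section Fourier

variable {V : Type*} [NormedAddCommGroup V] [InnerProductSpace ℝ V] [FiniteDimensional ℝ V]
  [MeasurableSpace V] [BorelSpace V] {f h : V → ℂ}

theorem continuous_fourier (hf : Integrable f) : Continuous (𝓕 f) :=
  VectorFourier.fourierIntegral_continuous Real.continuous_fourierChar (L := innerₗ V)
    continuous_inner hf

theorem continuous_fourierInv (hf : Integrable f) : Continuous (𝓕⁻ f) := by
  rw [Real.fourierInv_eq_fourier_comp_neg]
  exact continuous_fourier hf.comp_neg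

theorem integral_fourierInv_mul_eq (hf : Integrable f) (hh : Integrable h) :
    ∫ x, 𝓕⁻ f x * h x = ∫ x, f x * 𝓕⁻ h x := by
  have hflip : ∫ x, 𝓕 (fun y => f (-y)) x * h x = ∫ x, f (-x) * 𝓕 h x := by
    simpa using! VectorFourier.integral_fourierIntegral_smul_eq_flip (L := innerₗ V)
      Real.continuous_fourierChar continuous_inner hf.comp_neg hh
  rw [Real.fourierInv_eq_fourier_comp_neg, hflip, ← integral_neg_eq_self]
  simp [Real.fourierInv_eq_fourier_neg]

theorem toLp_fourierInv_ae_eq (hf : Integrable f) (hf2 : MemLp f 2) :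
    ((𝓕⁻ (hf2.toLp f) : Lp ℂ 2 (volume : Measure V)) : V → ℂ) =ᵐ[volume] 𝓕⁻ f := by
  refine ae_eq_of_integral_contDiff_smul_eq ((Lp.memLp _).locallyIntegrable one_le_two)
    (continuous_fourierInv hf).locallyIntegrable fun φ hφ hφc => ?_
  have hc : HasCompactSupport fun x => (φ x : ℂ) := hφc.comp_left (g := Complex.ofReal) rfl
  have hs : ContDiff ℝ (⊤ : ℕ∞) fun x => (φ x : ℂ) := Complex.ofRealCLM.contDiff.comp hφ
  have hdual := DFunLike.congr_fun (Lp.fourierInv_toTemperedDistribution_eq (hf2.toLp f))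
    (hc.toSchwartzMap hs)
  rw [TemperedDistribution.fourierInv_apply, Lp.toTemperedDistribution_apply,
    Lp.toTemperedDistribution_apply] at hdual
  have hcoe : ∫ x, (𝓕⁻ (hc.toSchwartzMap hs)) x • (hf2.toLp f : V → ℂ) x =
      ∫ x, 𝓕⁻ (fun x => (φ x : ℂ)) x * f x := by
    refine integral_congr_ae ?_
    filter_upwards [hf2.coeFn_toLp] with x hx
    rw [hx, SchwartzMap.fourierInv_coe]
    rfl
  rw [hcoe, integral_fourierInv_mul_eq (hs.continuous.integrable_of_hasCompactSupport hc) hf]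
    at hdual
  simpa using! hdual.symm

theorem memLp_fourierInv (hf : Integrable f) (hf2 : MemLp f 2) : MemLp (𝓕⁻ f) 2 :=
  (memLp_congr_ae (toLp_fourierInv_ae_eq hf hf2)).1 (Lp.memLp _)

theorem eLpNorm_fourierInv (hf : Integrable f) (hf2 : MemLp f 2) :
    eLpNorm (𝓕⁻ f) 2 = eLpNorm f 2 := by
  rw [← eLpNorm_congr_ae (toLp_fourierInv_ae_eq hf hf2), ← Lp.enorm_toLp hf2, ← Lp.enorm_def,
    ← ofReal_norm, ← ofReal_norm, ← Lp.norm_fourier_eq, FourierTransform.fourier_fourierInv_eq]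

theorem fourierInv_conj_comp_sub (x ξ : V) :
    𝓕⁻ (fun t => conj (f (t - x))) ξ = Real.fourierChar (inner ℝ x ξ) * conj (𝓕 f ξ) := by
  rw [Real.fourierInv_eq, Real.fourier_eq, ← integral_conj, ← integral_const_mul,
    ← integral_add_right_eq_self _ x]
  refine integral_congr_ae (ae_of_all _ fun t => ?_)
  simp only [Circle.smul_def, smul_eq_mul, map_mul, add_sub_cancel_right]
  rw [inner_add_left, add_comm, AddChar.map_add_eq_mul, AddChar.map_neg_eq_inv,
    ← Circle.coe_inv_eq_conj, inv_inv, Circle.coe_mul, mul_assoc]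

theorem memLp_mul_conj_fourier {p : ℝ≥0∞} (hf : MemLp f p) (hh : Integrable h) :
    MemLp (fun ξ => f ξ * conj (𝓕 h ξ)) p := by
  have hc : Continuous fun ξ => conj (𝓕 h ξ) := Complex.continuous_conj.comp (continuous_fourier hh)
  refine hf.of_le_mul (c := ∫ t, ‖h t‖) (hf.1.mul hc.aestronglyMeasurable)
    (ae_of_all _ fun ξ => ?_)
  rw [norm_mul, RCLike.norm_conj, mul_comm]
  gcongr
  exact VectorFourier.norm_fourierIntegral_le_integral_norm _ _ _ _ _

theorem integrable_mul_conj_fourier (hf : Integrable f) (hh : Integrable h) :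
    Integrable fun ξ => f ξ * conj (𝓕 h ξ) :=
  memLp_one_iff_integrable.1 (memLp_mul_conj_fourier (memLp_one_iff_integrable.2 hf) hh)

theorem eLpNorm_two_sq (f : V → ℂ) : eLpNorm f 2 ^ 2 = ∫⁻ x, ‖f x‖ₑ ^ 2 := by
  simpa using eLpNorm_nnreal_pow_eq_lintegral (f := f) (μ := volume) (p := 2) two_ne_zero

end Fourier

section FourierEnergy

variable {m : ℕ} {φ h : EuclideanSpace ℝ (Fin m) → ℂ} {K : Type*}
  {g : K → EuclideanSpace ℝ (Fin m) → ℂ}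

theorem pairing_fourierInv (hφ : Integrable φ) (hh : Integrable h)
    (x : EuclideanSpace ℝ (Fin m)) :
    pairing (𝓕⁻ φ) (translate x h) = 𝓕⁻ (fun ξ => φ ξ * conj (𝓕 h ξ)) x := by
  have hconj : Integrable fun t => conj (h (t - x)) :=
    Complex.conjLIE.integrable_comp_iff.2 (hh.comp_sub_right x)
  simp only [pairing, translate]
  rw [integral_fourierInv_mul_eq hφ hconj, Real.fourierInv_eq]
  refine integral_congr_ae (ae_of_all _ fun ξ => ?_)
  simp only [fourierInv_conj_comp_sub, Circle.smul_def, smul_eq_mul, real_inner_comm ξ x]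
  ring

theorem lintegral_pairing_fourierInv (hφ : Integrable φ) (hφ2 : MemLp φ 2) (hh : Integrable h) :
    ∫⁻ x, ‖pairing (𝓕⁻ φ) (translate x h)‖ₑ ^ 2 = ∫⁻ ξ, ‖φ ξ‖ₑ ^ 2 * ‖𝓕 h ξ‖ₑ ^ 2 := by
  simp only [pairing_fourierInv hφ hh]
  rw [← eLpNorm_two_sq, eLpNorm_fourierInv (integrable_mul_conj_fourier hφ hh)
    (memLp_mul_conj_fourier hφ2 hh), eLpNorm_two_sq]
  simp [mul_pow, enorm_mul]

theorem measurable_enorm_pairing_fourierInv_sq (hφ : Integrable φ) (hh : Integrable h) :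
    Measurable fun x => ‖pairing (𝓕⁻ φ) (translate x h)‖ₑ ^ 2 := by
  simp only [pairing_fourierInv hφ hh]
  exact (continuous_fourierInv (integrable_mul_conj_fourier hφ hh)).enorm.measurable.pow_const 2

theorem measurable_energy_fourierInv [Countable K] (hφ : Integrable φ)
    (hg : ∀ k, Integrable (g k)) : Measurable (energy g (𝓕⁻ φ)) :=
  Measurable.tsum fun k => measurable_enorm_pairing_fourierInv_sq hφ (hg k)

theorem measurable_tsum_fourier_sq [Countable K] (hg : ∀ k, Integrable (g k)) :
    Measurable fun ξ => ∑' k, ‖𝓕 (g k) ξ‖ₑ ^ 2 :=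
  Measurable.tsum fun k => (continuous_fourier (hg k)).enorm.measurable.pow_const 2

theorem lintegral_energy_fourierInv [Countable K] (hφ : Integrable φ) (hφ2 : MemLp φ 2)
    (hg : ∀ k, Integrable (g k)) :
    ∫⁻ x, energy g (𝓕⁻ φ) x = ∫⁻ ξ, ‖φ ξ‖ₑ ^ 2 * ∑' k, ‖𝓕 (g k) ξ‖ₑ ^ 2 := by
  unfold energy
  rw [lintegral_tsum fun k => (measurable_enorm_pairing_fourierInv_sq hφ (hg k)).aemeasurable]
  simp only [lintegral_pairing_fourierInv hφ hφ2 (hg _), ← ENNReal.tsum_mul_left]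
  rw [lintegral_tsum fun k => ?_]
  exact (hφ2.1.aemeasurable.enorm.pow_const 2).mul
    ((continuous_fourier (hg k)).enorm.measurable.pow_const 2).aemeasurable

variable {F : Type*} [MeasureSpace F] {Ω : Set F}

theorem measurable_windowEnergy_fourierInv [Countable K] (hφ : Integrable φ)
    (hg : ∀ k, Integrable (g k)) (hΩ : MeasurableSet Ω) :
    Measurable (windowEnergy g Ω (𝓕⁻ φ)) :=
  ((measurable_energy_fourierInv hφ hg).comp measurable_fst).indicator (measurable_snd hΩ)

theorem lintegral_windowEnergy_fourierInv [SFinite (volume : Measure F)] [Countable K]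
    (hφ : Integrable φ) (hφ2 : MemLp φ 2) (hg : ∀ k, Integrable (g k)) (hΩ : MeasurableSet Ω) :
    ∫⁻ q, windowEnergy g Ω (𝓕⁻ φ) q =
      ∫⁻ ξ, ‖φ ξ‖ₑ ^ 2 * (volume Ω * ∑' k, ‖𝓕 (g k) ξ‖ₑ ^ 2) := by
  have hsplit (q : EuclideanSpace ℝ (Fin m) × F) :
      windowEnergy g Ω (𝓕⁻ φ) q = energy g (𝓕⁻ φ) q.1 * Ω.indicator 1 q.2 := by
    by_cases hq : q.2 ∈ Ω <;> simp [windowEnergy, hq]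
  simp only [hsplit, Measure.volume_eq_prod]
  rw [lintegral_prod_mul (measurable_energy_fourierInv hφ hg).aemeasurable
      (measurable_one.indicator hΩ).aemeasurable, lintegral_indicator_one hΩ,
    lintegral_energy_fourierInv hφ hφ2 hg, mul_comm, ← lintegral_const_mul'' _ ?_]
  · simp only [mul_left_comm]
  · exact (hφ2.1.aemeasurable.enorm.pow_const 2).mul (measurable_tsum_fourier_sq hg).aemeasurable

end FourierEnergy

section ShiftedWindow

variable {m : ℕ} {K : Type*} {g : K → EuclideanSpace ℝ (Fin m) → ℂ}
  {Λ : Set (EuclideanSpace ℝ (Fin m))}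

theorem IsBessel.frameSum_translate_lt_top {B : ℝ} (hB : IsBessel g Λ B)
    {f : EuclideanSpace ℝ (Fin m) → ℂ} (hf : MemLp f 2) (y : EuclideanSpace ℝ (Fin m)) :
    frameSum g Λ (translate y f) < ∞ :=
  (hB _ (memLp_translate hf y)).trans_lt <|
    ENNReal.mul_lt_top ENNReal.ofReal_lt_top (ENNReal.pow_lt_top (memLp_translate hf y).2)

theorem isNormalizedTightFrame_iff_frameSum_eq : IsNormalizedTightFrame g Λ ↔
    ∀ f : EuclideanSpace ℝ (Fin m) → ℂ, MemLp f 2 → frameSum g Λ f = eLpNorm f 2 ^ 2 := by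
  simp only [IsNormalizedTightFrame, IsFrame, IsBessel, ENNReal.ofReal_one, one_mul, one_pos,
    true_and, ← forall_and, le_antisymm_iff]

variable {F : Type*} [NormedAddCommGroup F] [MeasurableSpace F] [BorelSpace F] [ProperSpace F]
  {Γ : Submodule ℤ (EuclideanSpace ℝ (Fin m) × F)} {Ω : Set F}

theorem IsBessel.modelSet_shift
    (hinj : Set.InjOn Prod.fst (Γ : Set (EuclideanSpace ℝ (Fin m) × F)))
    (hdense : Dense (Prod.snd '' (Γ : Set (EuclideanSpace ℝ (Fin m) × F))))
    (hΩ : IsCompact Ω) (hint : (interior Ω).Nonempty) {B : ℝ}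
    (hB : IsBessel g (modelSet Γ Ω) B) {s : F} (hs : ∀ γ : Γ, γ.1.2 + s ∉ frontier Ω) :
    IsBessel g (modelSet Γ ((· + s) ⁻¹' Ω)) B := fun _ hf =>
  frameSum_modelSet_shift_mem hinj hdense hΩ hint (hB.frameSum_translate_lt_top hf) isClosed_Iic
    (fun y => eLpNorm_translate hf y ▸ hB _ (memLp_translate hf y)) hs

theorem IsNormalizedTightFrame.modelSet_shift
    (hinj : Set.InjOn Prod.fst (Γ : Set (EuclideanSpace ℝ (Fin m) × F)))
    (hdense : Dense (Prod.snd '' (Γ : Set (EuclideanSpace ℝ (Fin m) × F))))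
    (hΩ : IsCompact Ω) (hint : (interior Ω).Nonempty)
    (hT : IsNormalizedTightFrame g (modelSet Γ Ω)) {s : F}
    (hs : ∀ γ : Γ, γ.1.2 + s ∉ frontier Ω) :
    IsNormalizedTightFrame g (modelSet Γ ((· + s) ⁻¹' Ω)) := by
  refine isNormalizedTightFrame_iff_frameSum_eq.2 fun f hf => ?_
  refine frameSum_modelSet_shift_mem hinj hdense hΩ hint
    (hT.2.2.1.frameSum_translate_lt_top hf) isClosed_singleton (fun y => ?_) hs
  rw [Set.mem_singleton_iff, ← eLpNorm_translate hf y]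
  exact isNormalizedTightFrame_iff_frameSum_eq.1 hT _ (memLp_translate hf y)

end ShiftedWindow

section TightFrame

variable {m : ℕ} {K : Type*} {g : K → EuclideanSpace ℝ (Fin m) → ℂ}
  {Λ : Set (EuclideanSpace ℝ (Fin m))} {f h : EuclideanSpace ℝ (Fin m) → ℂ}

theorem exists_schwartzMap_eLpNorm_sub_le {V E : Type*} [NormedAddCommGroup V]
    [InnerProductSpace ℝ V] [FiniteDimensional ℝ V] [MeasurableSpace V] [BorelSpace V]
    [NormedAddCommGroup E] [NormedSpace ℝ E] {μ : Measure V} [IsFiniteMeasureOnCompacts μ]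
    {p : ℝ≥0∞} (hp : p ≠ ∞) (hp' : 1 ≤ p) {f : V → E} (hf : MemLp f p μ) {ε : ℝ} (hε : 0 < ε) :
    ∃ ψ : SchwartzMap V E, eLpNorm (f - ⇑ψ) p μ ≤ ENNReal.ofReal ε := by
  obtain ⟨ψ, hψc, hψs, hψ⟩ := hf.exist_eLpNorm_sub_le hp hp' hε
  exact ⟨hψc.toSchwartzMap hψs, hψ⟩

theorem IsBessel.analysisNorm_le_add_eLpNorm_sub (hB : IsBessel g Λ 1)
    (hg : ∀ k, MemLp (g k) 2) (hf : MemLp f 2) (hh : MemLp h 2) :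
    analysisNorm g Λ h ≤ analysisNorm g Λ f + eLpNorm (h - f) 2 := by
  have hsub : MemLp (h - f) 2 := hh.sub hf
  have hadd := analysisNorm_add_le (Λ := Λ) hg hf hsub
  rw [add_sub_cancel] at hadd
  exact hadd.trans (add_le_add le_rfl (hB.analysisNorm_le hsub))

theorem IsBessel.eLpNorm_le_analysisNorm_of_schwartz (hB : IsBessel g Λ 1)
    (hg : ∀ k, MemLp (g k) 2)
    (hS : ∀ ψ : SchwartzMap (EuclideanSpace ℝ (Fin m)) ℂ, eLpNorm ψ 2 ≤ analysisNorm g Λ ψ)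
    (hf : MemLp f 2) : eLpNorm f 2 ≤ analysisNorm g Λ f := by
  have happrox (ε : ℝ) (hε : 0 < ε) :
      eLpNorm f 2 ≤ analysisNorm g Λ f + ENNReal.ofReal ε + ENNReal.ofReal ε := by
    obtain ⟨ψ, hψ⟩ := exists_schwartzMap_eLpNorm_sub_le ENNReal.ofNat_ne_top one_le_two hf hε
    have hψ2 : MemLp ψ 2 := ψ.memLp 2 volume
    have htri := eLpNorm_add_le hψ2.1 (hf.sub hψ2).1 one_le_two
    rw [add_sub_cancel] at htri
    refine htri.trans (add_le_add ((hS ψ).trans ?_) hψ)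
    refine (hB.analysisNorm_le_add_eLpNorm_sub hg hf hψ2).trans (add_le_add le_rfl ?_)
    rwa [eLpNorm_sub_comm]
  have hlim : Tendsto (fun ε => analysisNorm g Λ f + ENNReal.ofReal ε + ENNReal.ofReal ε) (𝓝[>] 0)
      (𝓝 (analysisNorm g Λ f)) := by
    have hcont : Continuous fun ε => analysisNorm g Λ f + ENNReal.ofReal ε + ENNReal.ofReal ε :=
      (continuous_const.add ENNReal.continuous_ofReal).add ENNReal.continuous_ofReal
    simpa using (hcont.tendsto 0).mono_left nhdsWithin_le_nhds
  exact ge_of_tendsto hlim (eventually_mem_nhdsWithin.mono happrox)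

theorem ae_forall_add_notMem {F ι : Type*} [AddGroup F] [MeasurableSpace F] [MeasurableAdd F]
    [Countable ι] {μ : Measure F} [μ.IsAddLeftInvariant] {N : Set F} (hN : μ N = 0) (a : ι → F) :
    ∀ᵐ s ∂μ, ∀ i, a i + s ∉ N :=
  ae_all_iff.2 fun i => measure_eq_zero_iff_ae_notMem.1 ((measure_preimage_add μ (a i) N).trans hN)

variable {F : Type*} [NormedAddCommGroup F] [NormedSpace ℝ F] [FiniteDimensional ℝ F]
  [MeasureSpace F] [BorelSpace F] [(volume : Measure F).IsAddHaarMeasure]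
  {Γ : Submodule ℤ (EuclideanSpace ℝ (Fin m) × F)} [DiscreteTopology Γ] [IsZLattice ℝ Γ]
  {Ω : Set F}

theorem ae_forall_snd_add_notMem_frontier (hfr : volume (frontier Ω) = 0) :
    ∀ᵐ p : EuclideanSpace ℝ (Fin m) × F, ∀ γ : Γ, γ.1.2 + p.2 ∉ frontier Ω :=
  Measure.quasiMeasurePreserving_snd.ae (ae_forall_add_notMem hfr fun γ : Γ => γ.1.2)

theorem IsNormalizedTightFrame.ae_volume_mul_tsum_fourier_eq [Countable K]
    (hinj : Set.InjOn Prod.fst (Γ : Set (EuclideanSpace ℝ (Fin m) × F)))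
    (hdense : Dense (Prod.snd '' (Γ : Set (EuclideanSpace ℝ (Fin m) × F))))
    (hΩ : IsCompact Ω) (hint : (interior Ω).Nonempty) (hfr : volume (frontier Ω) = 0)
    (hg : ∀ k, Integrable (g k)) (hT : IsNormalizedTightFrame g (modelSet Γ Ω)) :
    ∀ᵐ ξ, volume Ω * ∑' k, ‖𝓕 (g k) ξ‖ₑ ^ 2 = ENNReal.ofReal (ZLattice.covolume Γ) := by
  have hmean (φ : EuclideanSpace ℝ (Fin m) → ℂ) (hφ : Integrable φ) (hφ2 : MemLp φ 2) :
      ∫⁻ ξ, ‖φ ξ‖ₑ ^ 2 * (volume Ω * ∑' k, ‖𝓕 (g k) ξ‖ₑ ^ 2) =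
        (∫⁻ ξ, ‖φ ξ‖ₑ ^ 2) * ENNReal.ofReal (ZLattice.covolume Γ) := by
    have hper : ∀ᵐ p, periodization Γ (windowEnergy g Ω (𝓕⁻ φ)) p = ∫⁻ ξ, ‖φ ξ‖ₑ ^ 2 := by
      filter_upwards [ae_forall_snd_add_notMem_frontier (Γ := Γ) hfr] with p hp
      have hf := memLp_fourierInv hφ hφ2
      rw [periodization_windowEnergy hinj, isNormalizedTightFrame_iff_frameSum_eq.1
        (hT.modelSet_shift hinj hdense hΩ hint hp) _ (memLp_translate hf _), eLpNorm_translate hf,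
        eLpNorm_fourierInv hφ hφ2, eLpNorm_two_sq]
    rw [← lintegral_windowEnergy_fourierInv hφ hφ2 hg hΩ.measurableSet,
      lintegral_eq_of_periodization_ae_eq
        (measurable_windowEnergy_fourierInv hφ hg hΩ.measurableSet) hper]
  refine ae_eq_of_forall_setLIntegral_eq_of_sigmaFinite
    ((measurable_tsum_fourier_sq hg).const_mul _) measurable_const fun A hA hAfin => ?_
  have hind (u : EuclideanSpace ℝ (Fin m) → ℝ≥0∞) :
      ∫⁻ ξ, ‖A.indicator (1 : EuclideanSpace ℝ (Fin m) → ℂ) ξ‖ₑ ^ 2 * u ξ = ∫⁻ ξ in A, u ξ := by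
    rw [← lintegral_indicator hA]
    refine lintegral_congr fun ξ => ?_
    by_cases hξ : ξ ∈ A <;> simp [hξ]
  have hmemLp (p : ℝ≥0∞) : MemLp (A.indicator (1 : EuclideanSpace ℝ (Fin m) → ℂ)) p :=
    memLp_indicator_const p hA 1 (Or.inr hAfin.ne)
  have hA_mean := hmean _ (memLp_one_iff_integrable.1 (hmemLp 1)) (hmemLp 2)
  have hA_norm := hind 1
  simp only [Pi.one_apply, mul_one] at hA_norm
  rwa [hind, hA_norm, setLIntegral_one, mul_comm, ← setLIntegral_const] at hA_mean

theorem IsBessel.ae_periodization_windowEnergy_eq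
    (hinj : Set.InjOn Prod.fst (Γ : Set (EuclideanSpace ℝ (Fin m) × F)))
    (hdense : Dense (Prod.snd '' (Γ : Set (EuclideanSpace ℝ (Fin m) × F))))
    (hΩ : IsCompact Ω) (hint : (interior Ω).Nonempty) (hfr : volume (frontier Ω) = 0)
    (hB : IsBessel g (modelSet Γ Ω) 1) (hf : MemLp f 2)
    (hmeas : Measurable (windowEnergy g Ω f))
    (hmean : ∫⁻ q, windowEnergy g Ω f q =
      eLpNorm f 2 ^ 2 * ENNReal.ofReal (ZLattice.covolume Γ)) :
    ∀ᵐ p, periodization Γ (windowEnergy g Ω f) p = eLpNorm f 2 ^ 2 := by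
  refine periodization_ae_eq_of_ae_le hmeas (ENNReal.pow_ne_top hf.2.ne) ?_ hmean
  filter_upwards [ae_forall_snd_add_notMem_frontier (Γ := Γ) hfr] with p hp
  rw [periodization_windowEnergy hinj, ← eLpNorm_translate hf (-p.1)]
  simpa using hB.modelSet_shift hinj hdense hΩ hint hp _ (memLp_translate hf (-p.1))

theorem IsBessel.eLpNorm_le_analysisNorm_of_ae_eq
    (hinj : Set.InjOn Prod.fst (Γ : Set (EuclideanSpace ℝ (Fin m) × F)))
    (hdense : Dense (Prod.snd '' (Γ : Set (EuclideanSpace ℝ (Fin m) × F))))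
    (hΩ : IsCompact Ω) (hint : (interior Ω).Nonempty) (hfr : volume (frontier Ω) = 0)
    (hgen : IsGeneric Γ Ω) (hg : ∀ k, MemLp (g k) 2) (hB : IsBessel g (modelSet Γ Ω) 1)
    (hf : MemLp f 2)
    (hae : ∀ᵐ p, periodization Γ (windowEnergy g Ω f) p = eLpNorm f 2 ^ 2) :
    eLpNorm f 2 ≤ analysisNorm g (modelSet Γ Ω) f := by
  set G := {p : EuclideanSpace ℝ (Fin m) × F |
    periodization Γ (windowEnergy g Ω f) p = eLpNorm f 2 ^ 2 ∧
      ∀ γ : Γ, γ.1.2 + p.2 ∉ frontier Ω}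
  have hGdense : Dense G :=
    Measure.dense_of_ae (hae.and (ae_forall_snd_add_notMem_frontier (Γ := Γ) hfr))
  have : (𝓝[G] (0 : EuclideanSpace ℝ (Fin m) × F)).NeBot :=
    mem_closure_iff_nhdsWithin_neBot.1 (hGdense 0)
  have hgen0 (γ : Γ) : γ.1.2 + 0 ∉ frontier Ω := fun hγ =>
    Set.disjoint_left.1 hgen (by simpa using hγ) ⟨γ, γ.2, rfl⟩
  have hnorm : Tendsto (fun p : EuclideanSpace ℝ (Fin m) × F =>
      analysisNorm g (modelSet Γ ((· + p.2) ⁻¹' Ω)) f) (𝓝 0)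
      (𝓝 (analysisNorm g (modelSet Γ Ω) f)) := by
    have hcont := continuousAt_frameSum_modelSet_shift hinj hdense hΩ hint
      (hB.frameSum_translate_lt_top hf) hgen0
    have hsnd := continuous_snd.tendsto' (0 : EuclideanSpace ℝ (Fin m) × F) 0 rfl
    simpa [analysisNorm] using (hcont.tendsto.comp hsnd).ennrpow_const (1 / 2)
  have hsub : Tendsto (fun p : EuclideanSpace ℝ (Fin m) × F =>
      eLpNorm (translate (-p.1) f - f) 2) (𝓝 0) (𝓝 0) :=
    have : Fact ((2 : ℝ≥0∞) ≠ ∞) := ⟨ENNReal.ofNat_ne_top⟩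
    (tendsto_eLpNorm_translate_sub hf).comp (continuous_fst.tendsto' _ _ rfl)
  have hlim := (hnorm.add hsub).mono_left (nhdsWithin_le_nhds (s := G))
  rw [add_zero] at hlim
  refine ge_of_tendsto hlim ?_
  filter_upwards [self_mem_nhdsWithin] with p hp
  refine le_trans ?_ ((hB.modelSet_shift hinj hdense hΩ hint hp.2).analysisNorm_le_add_eLpNorm_sub
    hg hf (memLp_translate hf (-p.1)))
  rw [le_analysisNorm_iff, ← hp.1, periodization_windowEnergy hinj]

theorem IsBessel.isNormalizedTightFrame_of_ae_volume_mul_tsum_fourier_eq [Countable K]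
    (hinj : Set.InjOn Prod.fst (Γ : Set (EuclideanSpace ℝ (Fin m) × F)))
    (hdense : Dense (Prod.snd '' (Γ : Set (EuclideanSpace ℝ (Fin m) × F))))
    (hΩ : IsCompact Ω) (hint : (interior Ω).Nonempty) (hfr : volume (frontier Ω) = 0)
    (hgen : IsGeneric Γ Ω) (hg : ∀ k, Integrable (g k)) (hg2 : ∀ k, MemLp (g k) 2)
    (hB : IsBessel g (modelSet Γ Ω) 1)
    (hae : ∀ᵐ ξ, volume Ω * ∑' k, ‖𝓕 (g k) ξ‖ₑ ^ 2 = ENNReal.ofReal (ZLattice.covolume Γ)) :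
    IsNormalizedTightFrame g (modelSet Γ Ω) := by
  refine isNormalizedTightFrame_iff_frameSum_eq.2 fun f hf => le_antisymm (by simpa using hB f hf)
    (le_analysisNorm_iff.1 (hB.eLpNorm_le_analysisNorm_of_schwartz hg2 (fun ψ => ?_) hf))
  obtain ⟨φ, hψ⟩ : ∃ φ : SchwartzMap (EuclideanSpace ℝ (Fin m)) ℂ, 𝓕⁻ (φ : _ → ℂ) = ψ :=
    ⟨𝓕 ψ, by rw [← SchwartzMap.fourierInv_coe, FourierTransform.fourierInv_fourier_eq]⟩
  have hφ : Integrable φ := φ.integrable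
  have hφ2 : MemLp φ 2 := φ.memLp 2 volume
  rw [← hψ]
  have hf2 := memLp_fourierInv hφ hφ2
  refine hB.eLpNorm_le_analysisNorm_of_ae_eq hinj hdense hΩ hint hfr hgen hg2 hf2
    (hB.ae_periodization_windowEnergy_eq hinj hdense hΩ hint hfr hf2
      (measurable_windowEnergy_fourierInv hφ hg hΩ.measurableSet) ?_)
  rw [lintegral_windowEnergy_fourierInv hφ hφ2 hg hΩ.measurableSet, eLpNorm_fourierInv hφ hφ2,
    eLpNorm_two_sq, ← lintegral_mul_const'' _ (hφ2.1.aemeasurable.enorm.pow_const 2)]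
  refine lintegral_congr_ae ?_
  filter_upwards [hae] with ξ hξ
  rw [hξ]

end TightFrame

theorem density_mul_eq_one_iff {E : Type*} [NormedAddCommGroup E] [NormedSpace ℝ E]
    [FiniteDimensional ℝ E] [MeasureSpace E] [BorelSpace E]
    [(volume : Measure E).IsAddHaarMeasure] {Γ : Submodule ℤ E} [DiscreteTopology Γ]
    [IsZLattice ℝ Γ] {F : Type*} [MeasureSpace F] {Ω : Set F} (hΩ : volume Ω ≠ ∞) (a : ℝ≥0∞) :
    ENNReal.ofReal (volume.real Ω / ZLattice.covolume Γ) * a = 1 ↔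
      volume Ω * a = ENNReal.ofReal (ZLattice.covolume Γ) := by
  have hcov := ZLattice.covolume_pos Γ volume
  rw [ENNReal.ofReal_div_of_pos hcov, ofReal_measureReal hΩ, ← ENNReal.mul_div_right_comm,
    ENNReal.div_eq_one_iff (ENNReal.ofReal_pos.2 hcov).ne' ENNReal.ofReal_ne_top]

theorem IsWindow.interior_nonempty {F : Type*} [NormedAddCommGroup F] [MeasureSpace F]
    {Ω : Set F} (h : IsWindow Ω) : (interior Ω).Nonempty := by
  rw [← closure_nonempty_iff, h.closure_interior]
  exact h.nonempty

end ModelSetFrames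

open ModelSetFrames in
theorem theorem4p8_general {m : ℕ} {K : Type*} [Countable K] {F : Type*} [NormedAddCommGroup F]
    [NormedSpace ℝ F] [FiniteDimensional ℝ F] [MeasureSpace F] [BorelSpace F]
    [(volume : Measure F).IsAddHaarMeasure] (Γ : Submodule ℤ (EuclideanSpace ℝ (Fin m) × F))
    [DiscreteTopology Γ] [IsZLattice ℝ Γ]
    (hinj : Set.InjOn Prod.fst (Γ : Set (EuclideanSpace ℝ (Fin m) × F)))
    (hdense : Dense (Prod.snd '' (Γ : Set (EuclideanSpace ℝ (Fin m) × F)))) (Ω : Set F)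
    (hΩ : IsCompact Ω) (hint : (interior Ω).Nonempty) (hfr : volume (frontier Ω) = 0)
    (hgeneric : IsGeneric Γ Ω) (g : K → EuclideanSpace ℝ (Fin m) → ℂ)
    (hg : ∀ k, Integrable (g k)) (hg2 : ∀ k, MemLp (g k) 2) :
    HasDensity (modelSet Γ Ω) (density (modelSet Γ Ω)) ∧
      (IsNormalizedTightFrame g (modelSet Γ Ω) ↔ IsBessel g (modelSet Γ Ω) 1 ∧
        ∀ᵐ t, ENNReal.ofReal (density (modelSet Γ Ω)) * ∑' k, ‖𝓕 (g k) t‖ₑ ^ 2 = 1) := by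
  have hdens := hasDensity_modelSet hinj hdense hΩ hfr
  rw [hdens.density_eq]
  refine ⟨hdens, ?_⟩
  simp only [density_mul_eq_one_iff hΩ.measure_ne_top]
  exact ⟨fun hT => ⟨hT.2.2.1, hT.ae_volume_mul_tsum_fourier_eq hinj hdense hΩ hint hfr hg⟩,
    fun ⟨hB, hae⟩ => hB.isNormalizedTightFrame_of_ae_volume_mul_tsum_fourier_eq hinj hdense hΩ
      hint hfr hgeneric hg hg2 hae⟩

theorem theorem4p8 {m : ℕ} {K : Type*} [Countable K]
    (Γ : Submodule ℤ (EuclideanSpace ℝ (Fin m) × ℝ)) (Ω : Set ℝ)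
    (hsimple : ModelSetFrames.IsSimple Γ Ω)
    (hgeneric : ModelSetFrames.IsGeneric Γ Ω)
    (hsymm : ∀ x ∈ Ω, -x ∈ Ω)
    (g : K → EuclideanSpace ℝ (Fin m) → ℂ)
    (hg : ∀ k, ModelSetFrames.MemAmalgamOne 2 (g k)) :
    ModelSetFrames.HasDensity (ModelSetFrames.modelSet Γ Ω)
        (ModelSetFrames.density (ModelSetFrames.modelSet Γ Ω)) ∧
      (ModelSetFrames.IsNormalizedTightFrame g (ModelSetFrames.modelSet Γ Ω) ↔
        ModelSetFrames.IsBessel g (ModelSetFrames.modelSet Γ Ω) 1 ∧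
          ∀ᵐ t : EuclideanSpace ℝ (Fin m),
            ENNReal.ofReal (ModelSetFrames.density (ModelSetFrames.modelSet Γ Ω)) *
              ∑' k, ‖𝓕 (g k) t‖ₑ ^ 2 = 1) := by
  have := hsimple.lattice.discrete
  have : IsZLattice ℝ Γ := ⟨hsimple.lattice.span_eq_top⟩
  exact theorem4p8_general Γ hsimple.lattice.injOn_fst hsimple.lattice.dense_snd Ω
    hsimple.window.isCompact hsimple.window.interior_nonempty hsimple.window.frontier_null hgeneric
    g (fun k => ((hg k).mono one_le_two).integrable)
    (fun k => (hg k).memLp one_le_two ENNReal.ofNat_ne_top)
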